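/- Write $\mathbb{N}=\{0,1,2,\dots\}$ and let $\mathbb{N}^{\mathbb{N}}$ be the Baire space (product topology, $\mathbb{N}$ discrete). For $f,g\in\mathbb{N}^{\mathbb{N}}$ write $f\le^* g$ if $f(n)\le g(n)$ for all but finitely many $n$, and, for a free filter $\mathcal{F}$ on $\mathbb{N}$ (one that contains all cofinite sets and has only infinite members), write $f\le_{\mathcal{F}} g$ if $\{n: f(n)\le g(n)\}\in\mathcal{F}$. A family $Y\subseteq\mathbb{N}^{\mathbb{N}}$ is bounded with respect to $\le_{\mathcal{F}}$ if there is $g\in\mathbb{N}^{\mathbb{N}}$ with $f\le_{\mathcal{F}} g$ for all $f\in Y$, and unbounded otherwise. Let $\mathfrak{d}$ be the least cardinality of a family $D\subseteq\mathbb{N}^{\mathbb{N}}$ such that for each $g\in\mathbb{N}^{\mathbb{N}}$ there is $f\in D$ with $g\le^* f$. Let $\mathfrak{b}(\mathcal{F})$ be the least cardinality of a family in $\mathbb{N}^{\mathbb{N}}$ that is unbounded with respect to $\le_{\mathcal{F}}$. A $\mathfrak{b}(\mathcal{F})$-scale is a set $S=\{f_\alpha:\alpha<\mathfrak{b}(\mathcal{F})\}$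 of strictly increasing functions in $\mathbb{N}^{\mathbb{N}}$ that is unbounded with respect to $\le_{\mathcal{F}}$ and satisfies $f_\alpha\le_{\mathcal{F}} f_\beta$ for all $\alpha<\beta<\mathfrak{b}(\mathcal{F})$. Let $\mathbb{N}\cup\{\infty\}$ be the one-point compactification of $\mathbb{N}$, and let $Q\subseteq(\mathbb{N}\cup\{\infty\})^{\mathbb{N}}$ be the set of all sequences $(s_0,\dots,s_{m-1},\infty,\infty,\dots)$ with $m\ge 0$ and $s_0<\dots<s_{m-1}$ in $\mathbb{N}$. For $S\subseteq\mathbb{N}^{\mathbb{N}}$, the set $S\cup Q$ carries the subspace topology of $(\mathbb{N}\cup\{\infty\})^{\mathbb{N}}$. A space $X$ satisfies $\mathrm{Bdd}(\mathcal{F})$ if for each continuous $\Psi:X\to\mathbb{N}^{\mathbb{N}}$ the image $\Psi[X]$ is bounded with respect to $\le_{\mathcal{F}}$. It has the Hurewicz property if for each continuous $\Psi:X\to\mathbb{N}^{\mathbb{N}}$ there is $g\in\mathbb{N}^{\mathbb{N}}$ with $\Psi(x)\le^* g$ for all $x\in X$. A metrizable space $X$ has Menger's property if, for each metric inducing its topology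 and each basis $\mathcal{B}$ of $X$, there is a sequence $(B_n)_{n\in\mathbb{N}}$ in $\mathcal{B}$ with $\lim_{n\to\infty}\operatorname{diam}(B_n)=0$ and $X=\bigcup_n B_n$. **Theorem.** Assume that the cardinal $\mathfrak{d}$ is regular. Then there are a free ultrafilter $\mathcal{U}$ on $\mathbb{N}$ with $\mathfrak{b}(\mathcal{U})=\mathfrak{d}$ and a $\mathfrak{b}(\mathcal{U})$-scale $S=\{f_\alpha:\alpha<\mathfrak{d}\}$ such that, for $X=S\cup Q$, all finite powers $X^k$ satisfy $\mathrm{Bdd}(\mathcal{U})$ and, in particular, have Menger's property, but $X$ does not have the Hurewicz property. -/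

import Mathlib

open Filter Set Cardinal Topology

/-- The dominating number `𝔡`: the least cardinality of a family `D` of functions `ℕ → ℕ` such
that every `g : ℕ → ℕ` satisfies `g ≤* f` (at all but finitely many points) for some `f ∈ D`. -/
noncomputable def dominatingNumber : Cardinal.{0} :=
  sInf {c | ∃ D : Set (ℕ → ℕ), (∀ g : ℕ → ℕ, ∃ f ∈ D, g ≤ᶠ[cofinite] f) ∧ #D = c}

/-- A set `Y` of functions is bounded with respect to `≤_F`, where `f ≤_F g` means
`{n | f n ≤ g n} ∈ F`, that is, `f ≤ᶠ[F] g`. -/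
def BoundedMod (F : Filter ℕ) (Y : Set (ℕ → ℕ)) : Prop :=
  ∃ g : ℕ → ℕ, ∀ f ∈ Y, f ≤ᶠ[F] g

/-- The cardinal `𝔟(F)`: the least cardinality of a family of functions that is unbounded with
respect to `≤_F`. -/
noncomputable def boundingNumber (F : Filter ℕ) : Cardinal.{0} :=
  sInf {c | ∃ Y : Set (ℕ → ℕ), ¬ BoundedMod F Y ∧ #Y = c}

/-- `f = (f_α : α < 𝔟(F))` is a `𝔟(F)`-scale: all `f_α` are (strictly) increasing, the family is
unbounded with respect to `≤_F`, and `f_α ≤_F f_β` whenever `α < β < 𝔟(F)`. -/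
structure IsScale (F : Filter ℕ) (f : Set.Iio (boundingNumber F).ord → ℕ → ℕ) : Prop where
  strictMono : ∀ α, StrictMono (f α)
  unbounded : ¬ BoundedMod F (Set.range f)
  le_of_lt : ∀ α β, α < β → f α ≤ᶠ[F] f β

/-- The embedding of `ℕ → ℕ` into `ℕ → ℕ ∪ {∞}`, where `ℕ ∪ {∞}` is the one-point
compactification of the discrete space `ℕ`. -/
def toCompact (f : ℕ → ℕ) : ℕ → OnePoint ℕ := fun n => (f n : OnePoint ℕ)

/-- The sequence `q_s` that extends the finite sequence `s` by the constant value `∞`. -/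
def extendByInfty {m : ℕ} (s : Fin m → ℕ) : ℕ → OnePoint ℕ :=
  fun n => if h : n < m then (s ⟨n, h⟩ : OnePoint ℕ) else OnePoint.infty

/-- The countable set `Q` of all `q_s`, for `s` a finite increasing sequence. -/
def eventuallyInfty : Set (ℕ → OnePoint ℕ) :=
  {x | ∃ (m : ℕ) (s : Fin m → ℕ), StrictMono s ∧ x = extendByInfty s}

/-- The subspace `X = S ∪ Q` of the product space `ℕ → ℕ ∪ {∞}`, for `S = {f_α : α ∈ ι}`. -/
def scaleUnion {ι : Type*} (f : ι → ℕ → ℕ) : Set (ℕ → OnePoint ℕ) :=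
  Set.range (fun α => toCompact (f α)) ∪ eventuallyInfty

/-- `Bdd(F)`: each continuous image of `X` in the Baire space is bounded with respect to
`≤_F`. -/
def Bdd (F : Filter ℕ) (X : Type*) [TopologicalSpace X] : Prop :=
  ∀ Ψ : X → (ℕ → ℕ), Continuous Ψ → BoundedMod F (Set.range Ψ)

/-- The Hurewicz property: each continuous image of `X` in the Baire space is bounded with respect
to `≤*`. -/
def HurewiczProperty (X : Type*) [TopologicalSpace X] : Prop :=
  ∀ Ψ : X → (ℕ → ℕ), Continuous Ψ → ∃ g : ℕ → ℕ, ∀ x, ∀ᶠ n in cofinite, Ψ x n ≤ g n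

/-- Menger's basis property of a metric space: each basis contains a sequence of sets whose
diameters tend to `0` and whose union is the whole space. -/
def MengerBasisProperty (X : Type*) [MetricSpace X] : Prop :=
  ∀ B : Set (Set X), TopologicalSpace.IsTopologicalBasis B →
    ∃ b : ℕ → Set X, (∀ n, b n ∈ B) ∧
      Tendsto (fun n => Metric.ediam (b n)) atTop (𝓝 0) ∧ ⋃ n, b n = Set.univ

/-- Menger's property of a metrizable topological space: the basis property holds for every metric
that induces the topology. -/
def MengerProperty (X : Type*) [t : TopologicalSpace X] : Prop :=
  TopologicalSpace.MetrizableSpace X ∧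
    ∀ d : MetricSpace X, d.toUniformSpace.toTopologicalSpace = t → @MengerBasisProperty X d

/-! Fewer than `𝔡` functions, each restricted to an infinite set, can be matched infinitely often by
one function (`exists_forall_infinite_le`). Recursion of length `𝔡` along a dominating family thus
gives `h a ≥ d a` such that the sets on which finitely many `h a` increase with the index are
infinite. These sets lie in a free ultrafilter `U`; as `𝔡` is regular, fewer than `𝔡` functions are
bounded by a single `h c` modulo `U`, so `𝔟(U) = 𝔡`.

A set outside `U` can contain infinitely many intervals of prescribed length. On it a scale member
may take consecutive values without losing domination modulo `U`, so ranges can contain long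
intervals and still be co-infinite. The map sending `x` to its next omitted value is then not
`≤*`-bounded, which refutes Hurewicz.

`Bdd(U)` for powers is by induction on the exponent. Compactness gives `M` bounding `Ψ` at `n`
wherever all coordinates exceed `M n` there. Some `f b` exceeds `M` modulo `U`, so `M` handles the
points with all coordinates beyond `b`. Every other point has a coordinate among fewer than `𝔟(U)`
elements; fixing it lowers the exponent. -/

/-! ### Recursion and cardinality of initial segments -/

/-- Recursion along a well-order, when each step can be continued whatever the earlier values. -/
theorem exists_forall_of_forall_exists {ι X : Type*} [LinearOrder ι] [WellFoundedLT ι]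
    (P : (a : ι) → (Iio a → X) → X → Prop) (h : ∀ a p, ∃ x, P a p x) :
    ∃ f : ι → X, ∀ a, P a (fun b => f b) (f a) := by
  choose g hg using h
  refine ⟨wellFounded_lt.fix fun a p => g a fun b => p b b.2, fun a => ?_⟩
  rw [WellFounded.fix_eq]
  exact hg _ _

theorem mk_Iio_subtype_lt {κ : Cardinal.{0}} (a : Iio κ.ord) : #(Iio a) < lift.{1} κ := by
  have e : #(Iio a) ≤ #(Iio a.1) :=
    mk_le_of_injective (f := fun b : Iio a => (⟨b.1.1, b.2⟩ : Iio a.1))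
      fun x y h => Subtype.ext (Subtype.ext (congrArg (fun z : Iio a.1 => z.1) h))
  refine e.trans_lt ?_
  rw [mk_Iio_ordinal, lift_lt]
  exact lt_ord.1 a.2

theorem mk_range_Iio_lt {κ : Cardinal.{0}} {X : Type} (a : Iio κ.ord) (f : Iio a → X) :
    #(range f) < κ := by
  have h := mk_range_le_lift (f := f)
  rw [lift_id'.{0, 1}] at h
  exact lift_lt.{0, 1}.1 (h.trans_lt (mk_Iio_subtype_lt a))

theorem mk_range_Iic_lt {κ : Cardinal.{0}} (hκ : ℵ₀ ≤ κ) {X : Type} (a : Iio κ.ord)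
    (f : Iic a → X) : #(range f) < κ := by
  have : range f ⊆ insert (f ⟨a, self_mem_Iic⟩) (range fun b : Iio a => f ⟨b, (show b.1 < a from b.2).le⟩) := by
    rintro _ ⟨⟨b, hb⟩, rfl⟩
    rcases (show b ≤ a from hb).eq_or_lt with rfl | h
    · exact Or.inl rfl
    · exact Or.inr ⟨⟨b, h⟩, rfl⟩
  refine (mk_le_mk_of_subset this).trans_lt (mk_insert_le.trans_lt ?_)
  exact add_lt_of_lt hκ (mk_range_Iio_lt a _) (one_lt_aleph0.trans_le hκ)

theorem mk_range_finset_Iio_lt {κ : Cardinal.{0}} (hκ : ℵ₀ < κ) {X : Type} (a : Iio κ.ord)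
    (f : Finset (Iio a) → X) : #(range f) < κ := by
  have h := mk_range_le_lift (f := f)
  rw [lift_id'.{0, 1}] at h
  refine lift_lt.{0, 1}.1 (h.trans_lt ?_)
  cases finite_or_infinite (Iio a)
  · exact (mk_le_aleph0 (α := Finset (Iio a))).trans_lt (by simpa using lift_lt.{0, 1}.2 hκ)
  · rw [mk_finset_of_infinite]
    exact mk_Iio_subtype_lt a

theorem Cardinal.IsRegular.exists_forall_lt {κ : Cardinal.{0}} (hκ : κ.IsRegular) {Y : Type}
    (hY : #Y < κ) (b : Y → Iio κ.ord) : ∃ c : Iio κ.ord, ∀ y, b y < c := by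
  have : Order.IsSuccLimit κ.ord := isSuccLimit_ord hκ.aleph0_le
  refine ⟨⟨⨆ y, Order.succ (b y).1,
    Ordinal.iSup_lt_of_lt_cof (hY.trans_le hκ.le_cof_ord) fun y => this.succ_lt (b y).2⟩, fun y => ?_⟩
  show (b y).1 < _
  exact (Order.lt_succ _).trans_le (Ordinal.le_iSup (fun y => Order.succ (b y).1) y)

/-! ### The dominating number -/

theorem exists_dominating :
    ∃ D : Set (ℕ → ℕ), (∀ g : ℕ → ℕ, ∃ f ∈ D, g ≤ᶠ[cofinite] f) ∧ #D = dominatingNumber :=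
  csInf_mem (s := {c | ∃ D : Set (ℕ → ℕ), (∀ g : ℕ → ℕ, ∃ f ∈ D, g ≤ᶠ[cofinite] f) ∧ #D = c})
    ⟨_, univ, fun g => ⟨g, mem_univ _, EventuallyLE.rfl⟩, rfl⟩

theorem exists_forall_frequently_lt {Y : Set (ℕ → ℕ)} (hY : #Y < dominatingNumber) :
    ∃ g : ℕ → ℕ, ∀ f ∈ Y, ∃ᶠ n in cofinite, f n < g n := by
  by_contra! h
  refine notMem_of_lt_csInf' hY ⟨Y, fun g => ?_, rfl⟩
  obtain ⟨f, hf, hg⟩ := h g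
  exact ⟨f, hf, hg⟩

theorem exists_eventually_le_of_countable {J : Type*} [Countable J] (f : J → ℕ → ℕ) :
    ∃ g : ℕ → ℕ, ∀ j, f j ≤ᶠ[cofinite] g := by
  cases isEmpty_or_nonempty J
  · exact ⟨0, isEmptyElim⟩
  obtain ⟨e, he⟩ := exists_surjective_nat J
  refine ⟨fun n => (Finset.range (n + 1)).sup fun i => f (e i) n, fun j => ?_⟩
  obtain ⟨i, rfl⟩ := he j
  rw [Nat.cofinite_eq_atTop]
  filter_upwards [eventually_ge_atTop i] with n hn
  exact Finset.le_sup (f := fun i => f (e i) n) (Finset.mem_range.2 (Nat.lt_succ_of_le hn))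

theorem aleph0_lt_dominatingNumber : ℵ₀ < dominatingNumber := by
  obtain ⟨D, hD, hc⟩ := exists_dominating
  rw [← hc]
  by_contra! h
  have : Countable D := mk_le_aleph0_iff.1 h
  obtain ⟨g, hg⟩ := exists_eventually_le_of_countable (fun f : D => (f : ℕ → ℕ))
  obtain ⟨f, hf, hgf⟩ := hD fun n => g n + 1
  obtain ⟨n, h1, h2⟩ := ((hg ⟨f, hf⟩).and hgf).exists
  simp only at h1 h2
  omega

/-- Fewer than `𝔡` functions, each given on an infinite set, are simultaneously dominated
infinitely often by one function. -/
theorem exists_forall_infinite_le {J : Type*} (A : J → Set ℕ) (f : J → ℕ → ℕ)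
    (hJ : ∀ F : J → ℕ → ℕ, #(range F) < dominatingNumber) :
    ∃ x : ℕ → ℕ, ∀ j, (A j).Infinite → {n ∈ A j | f j n ≤ x n}.Infinite := by
  classical
  have hnext : ∀ j n, ∃ a, (A j).Infinite → a ∈ A j ∧ n ≤ a := fun j n => by
    by_cases h : (A j).Infinite
    · obtain ⟨a, ha, hn⟩ := h.exists_gt n
      exact ⟨a, fun _ => ⟨ha, hn.le⟩⟩
    · exact ⟨0, fun h' => absurd h' h⟩
  choose next hnext using hnext
  obtain ⟨g, hg⟩ := exists_forall_frequently_lt (hJ fun j n => f j (next j n))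
  -- The running maximum of `g` carries the bound at `n` over to the later point `next j n ≥ n`.
  refine ⟨fun n => (Finset.range (n + 1)).sup g, fun j hj => ?_⟩
  refine infinite_of_forall_exists_gt fun N => ?_
  have h1 := hg _ ⟨j, rfl⟩
  rw [Nat.cofinite_eq_atTop] at h1
  obtain ⟨n, h2, h3⟩ := (h1.and_eventually (eventually_gt_atTop N)).exists
  obtain ⟨h4, h5⟩ := hnext j n hj
  exact ⟨next j n, ⟨h4, h2.le.trans
    (Finset.le_sup (f := g) (Finset.mem_range.2 (Nat.lt_succ_of_le h5)))⟩, h3.trans_le h5⟩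

/-! ### An ultrafilter with `𝔟(U) = 𝔡` -/

/-- A family `h ≥ d` indexed by `𝔡` that is increasing modulo some free ultrafilter. -/
theorem exists_ultrafilter_increasing (d : Iio dominatingNumber.ord → ℕ → ℕ) :
    ∃ U : Ultrafilter ℕ, (U : Filter ℕ) ≤ cofinite ∧
      ∃ h : Iio dominatingNumber.ord → ℕ → ℕ, (∀ a, d a ≤ h a) ∧
        ∀ a b, a < b → h a ≤ᶠ[(U : Filter ℕ)] h b := by
  classical
  let ι := Iio dominatingNumber.ord
  -- Infinitude is a premise inside `P`, so the recursion can always continue; `hB` supplies it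
  -- afterwards, adding the largest index last.
  let P : (a : ι) → (Iio a → ℕ → ℕ) → (ℕ → ℕ) → Prop := fun a p x =>
    d a ≤ x ∧ ∀ T : Finset (Iio a),
      {n | ∀ b ∈ T, ∀ c ∈ T, b < c → p b n ≤ p c n}.Infinite →
      {n ∈ {n | ∀ b ∈ T, ∀ c ∈ T, b < c → p b n ≤ p c n} | ∀ b ∈ T, p b n ≤ x n}.Infinite
  obtain ⟨h, hh⟩ := exists_forall_of_forall_exists P fun a p => by
    obtain ⟨x, hx⟩ := exists_forall_infinite_le
      (fun T : Finset (Iio a) => {n | ∀ b ∈ T, ∀ c ∈ T, b < c → p b n ≤ p c n})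
      (fun T n => T.sup fun b => p b n)
      fun F => mk_range_finset_Iio_lt aleph0_lt_dominatingNumber a F
    refine ⟨x ⊔ d a, le_sup_right, fun T hT => (hx T hT).mono ?_⟩
    rintro n ⟨h1, h2⟩
    exact ⟨h1, fun b hb => ((Finset.le_sup (f := fun b => p b n) hb).trans h2).trans le_sup_left⟩
  let B : Finset ι → Set ℕ := fun T => {n | ∀ b ∈ T, ∀ c ∈ T, b < c → h b n ≤ h c n}
  have hB : ∀ T, (B T).Infinite := fun T => by
    induction T using Finset.induction_on_max with
    | empty => simpa [B] using infinite_univ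
    | insert a T hT ih =>
      have key := (hh a).2 (T.attach.image fun b => ⟨b.1, hT _ b.2⟩)
        (ih.mono fun n hn => by
          simp only [Finset.mem_image, Finset.mem_attach, true_and, mem_ofPred_eq]
          rintro _ ⟨b, rfl⟩ _ ⟨c, rfl⟩ hbc
          exact hn _ b.2 _ c.2 hbc)
      refine key.mono ?_
      rintro n ⟨h1, h2⟩ b hb c hc hbc
      simp only [Finset.mem_image, Finset.mem_attach, true_and, mem_ofPred_eq] at h1 h2
      rcases Finset.mem_insert.1 hb with rfl | hb'
      · rcases Finset.mem_insert.1 hc with rfl | hc'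
        · exact le_rfl
        · exact absurd (hT c hc') hbc.not_gt
      · rcases Finset.mem_insert.1 hc with rfl | hc'
        · exact h2 ⟨b, hT b hb'⟩ ⟨⟨b, hb'⟩, rfl⟩
        · exact h1 ⟨b, hT b hb'⟩ ⟨⟨b, hb'⟩, rfl⟩ ⟨c, hT c hc'⟩ ⟨⟨c, hc'⟩, rfl⟩ hbc
  have hne : (⨅ T, cofinite ⊓ 𝓟 (B T)).NeBot := by
    refine iInf_neBot_of_directed (fun S T => ⟨S ∪ T, ?_, ?_⟩)
      fun T => (hB T).cofinite_inf_principal_neBot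
    all_goals
      refine inf_le_inf_left _ (principal_mono.2 fun n hn b hb c hc => hn b ?_ c ?_) <;>
        simp [hb, hc]
  have hU := Ultrafilter.of_le (⨅ T, cofinite ⊓ 𝓟 (B T))
  refine ⟨Ultrafilter.of (⨅ T, cofinite ⊓ 𝓟 (B T)), hU.trans ((iInf_le _ ∅).trans inf_le_left),
    h, fun a => (hh a).1, fun a b hab => ?_⟩
  have : B {a, b} ∈ Ultrafilter.of (⨅ T, cofinite ⊓ 𝓟 (B T)) :=
    (hU.trans ((iInf_le _ {a, b}).trans inf_le_right)) (mem_principal_self _)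
  filter_upwards [this] with n hn
  exact hn a (by simp) b (by simp) hab

theorem boundedMod_of_mk_lt {F : Filter ℕ} {Y : Set (ℕ → ℕ)} (hY : #Y < boundingNumber F) :
    BoundedMod F Y := by
  by_contra h
  exact notMem_of_lt_csInf' hY ⟨Y, h, rfl⟩

theorem not_boundedMod_of_dominating {F : Filter ℕ} [F.NeBot] (hF : F ≤ cofinite)
    {D : Set (ℕ → ℕ)} (hD : ∀ g : ℕ → ℕ, ∃ f ∈ D, g ≤ᶠ[cofinite] f) : ¬ BoundedMod F D := by
  rintro ⟨g, hg⟩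
  obtain ⟨f, hf, hgf⟩ := hD fun n => g n + 1
  obtain ⟨n, h1, h2⟩ := ((hg f hf).and (hF hgf)).exists
  simp only at h1 h2
  omega

theorem exists_dominating_indexed : ∃ d : Iio dominatingNumber.ord → ℕ → ℕ,
    ∀ g : ℕ → ℕ, ∃ a, g ≤ᶠ[cofinite] d a := by
  obtain ⟨D, hD, hc⟩ := exists_dominating
  have : lift.{0} #(Iio dominatingNumber.ord) = lift.{1} #D := by
    rw [mk_Iio_ordinal, card_ord, hc, lift_id'.{0, 1}]
  obtain ⟨e⟩ := lift_mk_eq'.1 this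
  refine ⟨fun a => e a, fun g => ?_⟩
  obtain ⟨f, hf, hgf⟩ := hD g
  exact ⟨e.symm ⟨f, hf⟩, by simpa using hgf⟩

/-- If `𝔡` is regular, then `𝔟(U) = 𝔡` for some free ultrafilter `U` (Canjar). -/
theorem exists_boundingNumber_eq (hd : dominatingNumber.IsRegular) :
    ∃ U : Ultrafilter ℕ, (U : Filter ℕ) ≤ cofinite ∧
      boundingNumber (U : Filter ℕ) = dominatingNumber := by
  obtain ⟨d, hd'⟩ := exists_dominating_indexed
  obtain ⟨U, hU, h, hdh, hh⟩ := exists_ultrafilter_increasing d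
  refine ⟨U, hU, le_antisymm ?_ ?_⟩
  · obtain ⟨D, hD, hc⟩ := exists_dominating
    exact csInf_le' ⟨D, not_boundedMod_of_dominating hU hD, hc⟩
  · obtain ⟨D, hD, -⟩ := exists_dominating
    refine le_csInf ⟨_, D, not_boundedMod_of_dominating hU hD, rfl⟩ ?_
    rintro _ ⟨Y, hY, rfl⟩
    by_contra! hlt
    choose a ha using fun y : Y => hd' y
    obtain ⟨c, hc⟩ := hd.exists_forall_lt hlt a
    refine hY ⟨h c, fun y hy => ?_⟩
    filter_upwards [hU (ha ⟨y, hy⟩), hh _ _ (hc ⟨y, hy⟩)] with n h1 h2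
    exact (h1.trans (hdh _ n)).trans h2

/-! ### Scales whose ranges contain long intervals -/

/-- An ultrafilter misses a set that contains infinitely many intervals of prescribed length. -/
theorem Ultrafilter.exists_notMem_frequently_Ioc (U : Ultrafilter ℕ) (G : ℕ → ℕ) :
    ∃ E : Set ℕ, E ∉ U ∧ ∃ᶠ n in atTop, Ioc n (G n) ⊆ E := by
  let s : ℕ → ℕ := fun i => Nat.rec 0 (fun _ m => m + 1 + G m) i
  have hs : ∀ i, s (i + 1) = s i + 1 + G (s i) := fun _ => rfl
  have hmono : StrictMono s := strictMono_nat_of_lt_succ fun i => by rw [hs]; omega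
  have hdisj := hmono.monotone.pairwise_disjoint_on_Ioc_succ
  have hsub : ∀ i, Ioc (s i) (G (s i)) ⊆ Ioc (s i) (s (i + 1)) := fun i =>
    Ioc_subset_Ioc_right (by rw [hs]; omega)
  -- Both the even blocks and their complement contain infinitely many of the intervals, and `U`
  -- misses one of the two sets.
  let E : Set ℕ := ⋃ i, Ioc (s (2 * i)) (s (2 * i + 1))
  by_cases hE : E ∈ U
  · refine ⟨Eᶜ, Ultrafilter.compl_notMem_iff.2 hE, frequently_atTop.2 fun N => ?_⟩
    refine ⟨s (2 * N + 1), (show N ≤ 2 * N + 1 by omega).trans (hmono.le_apply), ?_⟩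
    refine subset_compl_iff_disjoint_right.2 (Disjoint.mono_left (hsub (2 * N + 1)) ?_)
    refine disjoint_iUnion_right.2 fun i => ?_
    exact hdisj (show 2 * N + 1 ≠ 2 * i by omega)
  · refine ⟨E, hE, frequently_atTop.2 fun N => ?_⟩
    refine ⟨s (2 * N), (show N ≤ 2 * N by omega).trans (hmono.le_apply), ?_⟩
    exact (hsub (2 * N)).trans (subset_iUnion (fun i => Ioc (s (2 * i)) (s (2 * i + 1))) N)

/-- A function that dominates `h` modulo `U` may have a range that is co-infinite but contains
infinitely many intervals of prescribed length. -/
theorem Ultrafilter.exists_strictMono_frequently_Icc (U : Ultrafilter ℕ)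
    (hU : (U : Filter ℕ) ≤ cofinite) (h e : ℕ → ℕ) :
    ∃ f : ℕ → ℕ, StrictMono f ∧ h ≤ᶠ[(U : Filter ℕ)] f ∧ (range f)ᶜ.Infinite ∧
      ∃ᶠ n in atTop, Icc n (e n) ⊆ range f := by
  classical
  -- Steps in `E` produce consecutive values; the others jump above `h` and skip at least one value.
  let φ : Set ℕ → ℕ → ℕ := fun E n =>
    Nat.rec 0 (fun m y => if m + 1 ∈ E then y + 1 else y + 2 + h (m + 1)) n
  have hφ : ∀ E n, φ E (n + 1) = if n + 1 ∈ E then φ E n + 1 else φ E n + 2 + h (n + 1) :=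
    fun _ _ => rfl
  have hle : ∀ E n, φ E n ≤ φ ∅ n := fun E n => by
    induction n with
    | zero => exact le_rfl
    | succ n ih => rw [hφ, hφ]; split_ifs <;> simp_all; omega
  have hmono : ∀ E, StrictMono (φ E) := fun E => strictMono_nat_of_lt_succ fun n => by
    rw [hφ]; split_ifs <;> omega
  -- The lengths must be fixed before `E` is known; since `φ E n ≤ φ ∅ n`, this maximum is at least
  -- `e (φ E n)`.
  obtain ⟨E, hE, hG⟩ :=
    U.exists_notMem_frequently_Ioc fun n => n + (Finset.range (φ ∅ n + 1)).sup e
  have hEc : ∀ᶠ n in (U : Filter ℕ), n ∉ E := Ultrafilter.compl_mem_iff_notMem.2 hE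
  have hpos : ∀ᶠ n in (U : Filter ℕ), n ≠ 0 := hU (by simp)
  refine ⟨φ E, hmono E, ?_, ?_, ?_⟩
  · filter_upwards [hEc, hpos] with n h1 h2
    obtain ⟨m, rfl⟩ := Nat.exists_eq_succ_of_ne_zero h2
    rw [Nat.succ_eq_add_one, hφ, if_neg h1]
    omega
  · refine infinite_of_forall_exists_gt fun N => ?_
    have hN : ∀ᶠ n in (U : Filter ℕ), N + 1 < n := by
      refine hU ?_
      rw [Nat.cofinite_eq_atTop]
      exact eventually_gt_atTop _
    obtain ⟨n, h1, h2⟩ := (hEc.and hN).exists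
    obtain ⟨m, rfl⟩ : ∃ m, n = m + 1 := ⟨n - 1, by omega⟩
    refine ⟨φ E m + 1, ?_, ?_⟩
    · rintro ⟨i, hi⟩
      rcases Nat.lt_or_ge i (m + 1) with h3 | h3
      · have := (hmono E).monotone (Nat.le_of_lt_succ h3)
        omega
      · have := (hmono E).monotone h3
        rw [hφ, if_neg h1] at this
        omega
    · have := (hmono E).le_apply (x := m)
      show N < φ E m + 1
      omega
  · refine frequently_atTop.2 fun N => ?_
    obtain ⟨n, hn, hI⟩ := frequently_atTop.1 hG N
    refine ⟨φ E n, hn.trans (hmono E).le_apply, ?_⟩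
    have hrun : ∀ j, n + j ≤ n + (Finset.range (φ ∅ n + 1)).sup e → φ E (n + j) = φ E n + j := by
      intro j
      induction j with
      | zero => intro _; rfl
      | succ j ih =>
        intro hj
        rw [← add_assoc, hφ, if_pos (hI ⟨by omega, by omega⟩), ih (by omega)]
        omega
    rintro y ⟨h1, h2⟩
    have h3 : e (φ E n) ≤ (Finset.range (φ ∅ n + 1)).sup e :=
      Finset.le_sup (Finset.mem_range.2 (Nat.lt_succ_of_le (hle E n)))
    refine ⟨n + (y - φ E n), ?_⟩
    rw [hrun _ (by omega)]
    omega

/-- If `𝔟(U) = 𝔡`, there is a scale whose members have co-infinite ranges that contain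
unboundedly long intervals. -/
theorem exists_isScale_frequently_Icc {U : Ultrafilter ℕ} (hU : (U : Filter ℕ) ≤ cofinite)
    (hb : boundingNumber (U : Filter ℕ) = dominatingNumber) :
    ∃ f : Iio (boundingNumber (U : Filter ℕ)).ord → ℕ → ℕ, IsScale (U : Filter ℕ) f ∧
      (∀ a, (range (f a))ᶜ.Infinite) ∧
      ∀ g : ℕ → ℕ, ∃ a, ∃ᶠ n in atTop, Icc n (g n) ⊆ range (f a) := by
  obtain ⟨d, hd⟩ : ∃ d : Iio (boundingNumber (U : Filter ℕ)).ord → ℕ → ℕ,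
      ∀ g : ℕ → ℕ, ∃ a, g ≤ᶠ[cofinite] d a := by
    rw [hb]; exact exists_dominating_indexed
  obtain ⟨f, hf⟩ := exists_forall_of_forall_exists
    (fun (a : Iio (boundingNumber (U : Filter ℕ)).ord) (p : Iio a → ℕ → ℕ) (x : ℕ → ℕ) =>
      StrictMono x ∧ (∀ b, p b ≤ᶠ[(U : Filter ℕ)] x) ∧ d a ≤ᶠ[(U : Filter ℕ)] x ∧
        (range x)ᶜ.Infinite ∧ ∃ᶠ n in atTop, Icc n (d a n) ⊆ range x) fun a p => by
    obtain ⟨g, hg⟩ := boundedMod_of_mk_lt (mk_range_Iio_lt a p)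
    obtain ⟨x, h1, h2, h3, h4⟩ := U.exists_strictMono_frequently_Icc hU (g ⊔ d a) (d a)
    refine ⟨x, h1, fun b => ?_, ?_, h3, h4⟩
    · filter_upwards [hg _ ⟨b, rfl⟩, h2] with n h5 h6
      exact h5.trans (le_sup_left.trans h6)
    · filter_upwards [h2] with n h6
      exact le_sup_right.trans h6
  refine ⟨f, ⟨fun a => (hf a).1, ?_, fun a b hab => (hf b).2.1 ⟨a, hab⟩⟩,
    fun a => (hf a).2.2.2.1, fun g => ?_⟩
  · rintro ⟨g, hg⟩
    obtain ⟨a, ha⟩ := hd fun n => g n + 1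
    obtain ⟨n, h1, h2, h3⟩ := ((hg _ ⟨a, rfl⟩).and ((ha.filter_mono hU).and (hf a).2.2.1)).exists
    simp only at h1 h2 h3
    omega
  · obtain ⟨a, ha⟩ := hd g
    rw [Nat.cofinite_eq_atTop] at ha
    refine ⟨a, ((hf a).2.2.2.2.and_eventually ha).mono ?_⟩
    rintro n ⟨h1, h2⟩
    exact (Icc_subset_Icc_right h2).trans h1

/-! ### The compact space of increasing sequences -/

theorem isClopen_singleton_onePoint (a : ℕ) : IsClopen {(a : OnePoint ℕ)} := by
  refine ⟨isClosed_singleton, ?_⟩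
  simpa using OnePoint.isOpenEmbedding_coe.isOpenMap {a} (isOpen_discrete _)

theorem isClopen_apply_eq_coe (n a : ℕ) : IsClopen {x : ℕ → OnePoint ℕ | x n = a} :=
  (isClopen_singleton_onePoint a).preimage (continuous_apply n)

/-- The sequences in `ℕ ∪ {∞}` that increase strictly up to their first value `∞`, if any, and are
constant from there on. -/
def increasingSeqs : Set (ℕ → OnePoint ℕ) :=
  {x | ∀ (n b : ℕ), x (n + 1) = b → ∃ a < b, x n = a}

/-- A finite value `b` leaves finitely many candidates `a < b`, so each condition is clopen. -/
theorem isClosed_increasingSeqs : IsClosed increasingSeqs := by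
  have : increasingSeqs = ⋂ (n : ℕ) (b : ℕ),
      ({x : ℕ → OnePoint ℕ | x (n + 1) = b}ᶜ ∪ ⋃ a ∈ Finset.range b, {x : ℕ → OnePoint ℕ | x n = a}) := by
    ext x
    simp only [increasingSeqs, mem_ofPred_eq, mem_iInter, mem_union, mem_compl_iff, mem_iUnion,
      Finset.mem_range, exists_prop, imp_iff_not_or]
  rw [this]
  refine isClosed_iInter fun n => isClosed_iInter fun b => IsClosed.union ?_ ?_
  · exact (isClopen_apply_eq_coe (n + 1) b).compl.isClosed
  · exact (isClopen_biUnion_finset fun a _ => isClopen_apply_eq_coe n a).isClosed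

theorem toCompact_mem_increasingSeqs {f : ℕ → ℕ} (hf : StrictMono f) :
    toCompact f ∈ increasingSeqs := fun n _ h =>
  ⟨f n, (hf n.lt_succ_self).trans_eq (OnePoint.coe_injective h), rfl⟩

theorem eventuallyInfty_subset_increasingSeqs : eventuallyInfty ⊆ increasingSeqs := by
  rintro _ ⟨m, s, hs, rfl⟩ n b h
  by_cases hn : n + 1 < m
  · simp only [extendByInfty, dif_pos hn] at h
    refine ⟨s ⟨n, by omega⟩, ?_, by simp [extendByInfty, show n < m by omega]⟩
    rw [← OnePoint.coe_injective h]
    exact hs (Fin.mk_lt_mk.2 n.lt_succ_self)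
  · simp [extendByInfty, dif_neg hn] at h

/-- Finiteness passes from `n + 1` down to `n`, so `∞` persists once reached, and the values before
the first `∞` form `s`. -/
theorem mem_eventuallyInfty_of_apply_eq {x : ℕ → OnePoint ℕ} (hx : x ∈ increasingSeqs) {n : ℕ}
    (hn : x n = OnePoint.infty) : x ∈ eventuallyInfty := by
  classical
  have hex : ∃ n, x n = OnePoint.infty := ⟨n, hn⟩
  have hlt : ∀ i : Fin (Nat.find hex), ∃ a : ℕ, (a : OnePoint ℕ) = x i := fun i =>
    OnePoint.ne_infty_iff_exists.1 (Nat.find_min hex i.2)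
  choose s hs using hlt
  refine ⟨Nat.find hex, s, ?_, ?_⟩
  · have hstep : ∀ (i j : ℕ) (hj : i + j + 1 < Nat.find hex),
        s ⟨i, by omega⟩ < s ⟨i + j + 1, hj⟩ := by
      intro i j
      induction j with
      | zero =>
        intro hj
        obtain ⟨a, h1, h2⟩ := hx i _ (hs ⟨i + 1, hj⟩).symm
        rw [← hs ⟨i, by omega⟩] at h2
        rwa [OnePoint.coe_injective h2]
      | succ j ih =>
        intro hj
        refine (ih (by omega)).trans ?_
        obtain ⟨a, h1, h2⟩ := hx (i + j + 1) _ (hs ⟨i + (j + 1) + 1, hj⟩).symm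
        rw [← hs ⟨i + j + 1, by omega⟩] at h2
        rwa [OnePoint.coe_injective h2]
    rintro ⟨i, hi⟩ ⟨j, hj⟩ hij
    obtain ⟨k, rfl⟩ := Nat.exists_eq_add_of_lt (Fin.mk_lt_mk.1 hij)
    exact hstep i k hj
  · funext i
    by_cases hi : i < Nat.find hex
    · simp [extendByInfty, hi, hs]
    · simp only [extendByInfty, dif_neg hi]
      obtain ⟨k, rfl⟩ := Nat.exists_eq_add_of_le (not_lt.1 hi)
      clear hi
      induction k with
      | zero => exact Nat.find_spec hex
      | succ k ih =>
        by_contra h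
        obtain ⟨b, hb⟩ := OnePoint.ne_infty_iff_exists.1 h
        obtain ⟨a, -, ha⟩ := hx _ b hb.symm
        exact OnePoint.infty_ne_coe _ (ih.symm.trans ha)

theorem countable_eventuallyInfty : eventuallyInfty.Countable := by
  have : eventuallyInfty ⊆ range fun p : Σ m, Fin m → ℕ => extendByInfty p.2 := by
    rintro _ ⟨m, s, -, rfl⟩
    exact ⟨⟨m, s⟩, rfl⟩
  exact (countable_range _).mono this

/-- A continuous function on a power of `X` is bounded on the points whose coordinates are all
large at `n`, provided that `X` contains the eventually infinite sequences. -/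
theorem exists_forall_le_of_forall_apply_ne {X : Set (ℕ → OnePoint ℕ)} (hX : eventuallyInfty ⊆ X)
    (hX' : X ⊆ increasingSeqs) {κ : Type*} (ψ : (κ → X) → ℕ) (hψ : Continuous ψ) (n : ℕ) :
    ∃ M : ℕ, ∀ x : κ → X, (∀ i, ∀ a ≤ M, (x i : ℕ → OnePoint ℕ) n ≠ a) → ψ x ≤ M := by
  have hind : IsInducing fun (x : κ → X) (i : κ) => (x i : ℕ → OnePoint ℕ) :=
    IsInducing.piMap fun _ => IsInducing.subtypeVal
  have hV : ∀ m : ℕ, ∃ V : Set (κ → ℕ → OnePoint ℕ), IsOpen V ∧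
      (fun (x : κ → X) (i : κ) => (x i : ℕ → OnePoint ℕ)) ⁻¹' V = ψ ⁻¹' Iic m := fun m =>
    hind.isOpen_iff.1 ((isOpen_discrete (Iic m)).preimage hψ)
  choose V hVo hV using hV
  let W : ℕ → Set (κ → ℕ → OnePoint ℕ) := fun m =>
    V m ∪ ⋃ (i : κ) (a : Iic m), {z | z i n = (a : ℕ)}
  have hW : ∀ m, IsOpen (W m) := fun m =>
    (hVo m).union (isOpen_iUnion fun i => isOpen_iUnion fun a =>
      ((isClopen_singleton_onePoint a).preimage (continuous_apply_apply i n)).isOpen)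
  have hK : IsCompact (Set.univ.pi fun _ : κ => increasingSeqs) :=
    isCompact_univ_pi fun _ => isClosed_increasingSeqs.isCompact
  -- A point with a finite coordinate value at `n` is covered through that value; otherwise all its
  -- coordinates lie in `Q`, where `ψ` is defined.
  obtain ⟨t, ht⟩ := hK.elim_finite_subcover W hW fun z hz => by
    by_cases h : ∃ i, z i n ≠ OnePoint.infty
    · obtain ⟨i, hi⟩ := h
      obtain ⟨a, ha⟩ := OnePoint.ne_infty_iff_exists.1 hi
      exact mem_iUnion.2 ⟨a, Or.inr (mem_iUnion₂.2 ⟨i, ⟨a, self_mem_Iic⟩, ha.symm⟩)⟩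
    · push Not at h
      have hmem : ∀ i, z i ∈ X := fun i =>
        hX (mem_eventuallyInfty_of_apply_eq (hz i (mem_univ i)) (h i))
      let x : κ → X := fun i => ⟨z i, hmem i⟩
      have hx : x ∈ ψ ⁻¹' Iic (ψ x) := le_refl (ψ x)
      rw [← hV] at hx
      exact mem_iUnion.2 ⟨ψ x, Or.inl hx⟩
  refine ⟨t.sup id, fun x hx => ?_⟩
  obtain ⟨m, hm, hxm⟩ := mem_iUnion₂.1
    (ht (show (fun i => (x i : ℕ → OnePoint ℕ)) ∈ _ from fun i _ => hX' (x i).2))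
  have hle : m ≤ t.sup id := Finset.le_sup (f := id) hm
  rcases hxm with h | h
  · have : x ∈ ψ ⁻¹' Iic m := by rw [← hV]; exact h
    exact le_trans this hle
  · obtain ⟨i, ⟨a, ha⟩, h⟩ := mem_iUnion₂.1 h
    exact absurd h (hx i a (le_trans ha hle))

theorem scaleUnion_subset_increasingSeqs {ι : Type*} {f : ι → ℕ → ℕ} (hf : ∀ a, StrictMono (f a)) :
    scaleUnion f ⊆ increasingSeqs :=
  union_subset (range_subset_iff.2 fun a => toCompact_mem_increasingSeqs (hf a))
    eventuallyInfty_subset_increasingSeqs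

/-! ### Boundedness of the finite powers -/

theorem aleph0_lt_boundingNumber {F : Filter ℕ} [F.NeBot] (hF : F ≤ cofinite) :
    ℵ₀ < boundingNumber F := by
  obtain ⟨D, hD, -⟩ := exists_dominating
  have hmem : boundingNumber F ∈ {c | ∃ Y : Set (ℕ → ℕ), ¬ BoundedMod F Y ∧ #Y = c} :=
    csInf_mem ⟨_, D, not_boundedMod_of_dominating hF hD, rfl⟩
  obtain ⟨Y, hY, hc⟩ := hmem
  rw [← hc]
  by_contra! h
  have : Countable Y := mk_le_aleph0_iff.1 h
  obtain ⟨g, hg⟩ := exists_eventually_le_of_countable (fun f : Y => (f : ℕ → ℕ))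
  exact hY ⟨g, fun f hf => hF (hg ⟨f, hf⟩)⟩

/-- All finite powers of `S ∪ Q` satisfy `Bdd(U)`, for `S` a `𝔟(U)`-scale. -/
theorem IsScale.bdd_pi {U : Ultrafilter ℕ} (hU : (U : Filter ℕ) ≤ cofinite)
    {f : Iio (boundingNumber (U : Filter ℕ)).ord → ℕ → ℕ} (hf : IsScale (U : Filter ℕ) f)
    (k : ℕ) : Bdd (U : Filter ℕ) (Fin k → scaleUnion f) := by
  have hal := aleph0_lt_boundingNumber hU
  induction k with
  | zero =>
    intro Ψ _
    refine ⟨Ψ default, ?_⟩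
    rintro _ ⟨x, rfl⟩
    rw [Subsingleton.elim x default]
  | succ k ih =>
    intro Ψ hΨ
    choose M hM using fun n => exists_forall_le_of_forall_apply_ne
      (X := scaleUnion f) subset_union_right (scaleUnion_subset_increasingSeqs hf.strictMono)
      (fun x => Ψ x n) ((continuous_apply n).comp hΨ) n
    obtain ⟨b, hb⟩ : ∃ b, ¬ f b ≤ᶠ[(U : Filter ℕ)] M := by
      by_contra! h
      exact hf.unbounded ⟨M, by rintro _ ⟨a, rfl⟩; exact h a⟩
    have hb' : ∀ᶠ n in (U : Filter ℕ), M n < f b n :=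
      (Ultrafilter.eventually_not.2 hb).mono fun n hn => not_le.1 hn
    let Y : Set (ℕ → OnePoint ℕ) := (range fun a : Iic b => toCompact (f a)) ∪ eventuallyInfty
    have hY : #Y < boundingNumber (U : Filter ℕ) :=
      (mk_union_le _ _).trans_lt (add_lt_of_lt hal.le (mk_range_Iic_lt hal.le b _)
        ((mk_le_aleph0_iff.2 countable_eventuallyInfty.to_subtype).trans_lt hal))
    have hYX : ∀ y : Y, y.1 ∈ scaleUnion f := by
      rintro ⟨_, ⟨a, rfl⟩ | h⟩
      · exact Or.inl ⟨a, rfl⟩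
      · exact Or.inr h
    have hG : ∀ p : Fin (k + 1) × Y, ∃ g : ℕ → ℕ, ∀ x : Fin k → scaleUnion f,
        Ψ (p.1.insertNth ⟨p.2.1, hYX p.2⟩ x) ≤ᶠ[(U : Filter ℕ)] g := fun p => by
      obtain ⟨g, hg⟩ := ih
        (fun x => Ψ (p.1.insertNth (α := fun _ => scaleUnion f) ⟨p.2.1, hYX p.2⟩ x))
        (hΨ.comp (continuous_const.finInsertNth p.1 continuous_id))
      exact ⟨g, fun x => hg _ ⟨x, rfl⟩⟩
    choose G hG using hG
    have hGc : #(range G) < boundingNumber (U : Filter ℕ) := by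
      refine mk_range_le.trans_lt ?_
      rw [mk_prod, lift_id, lift_id]
      exact mul_lt_of_lt hal.le ((mk_le_aleph0 (α := Fin (k + 1))).trans_lt hal) hY
    obtain ⟨g, hg⟩ := boundedMod_of_mk_lt hGc
    refine ⟨g ⊔ M, ?_⟩
    rintro _ ⟨x, rfl⟩
    by_cases h : ∃ i, (x i).1 ∈ Y
    · obtain ⟨i, hi⟩ := h
      have h1 := hG (i, ⟨_, hi⟩) (i.removeNth x)
      rw [show i.insertNth (α := fun _ => scaleUnion f) ⟨(x i).1, hYX ⟨_, hi⟩⟩ (i.removeNth x) = x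
        from Fin.insertNth_self_removeNth i x] at h1
      filter_upwards [h1, hg _ ⟨(i, ⟨_, hi⟩), rfl⟩] with n h2 h3
      exact (h2.trans h3).trans le_sup_left
    · push Not at h
      have hx : ∀ i, ∀ᶠ n in (U : Filter ℕ), ∀ a ≤ M n, (x i : ℕ → OnePoint ℕ) n ≠ a := by
        intro i
        rcases (x i).2 with ⟨a, ha⟩ | hQ
        · have hab : b < a := by
            by_contra hle
            exact h i (Or.inl ⟨⟨a, not_lt.1 hle⟩, ha⟩)
          filter_upwards [hb', hf.le_of_lt b a hab] with n h1 h2 c hc heq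
          rw [← ha] at heq
          have := OnePoint.coe_injective heq
          omega
        · exact absurd (Or.inr hQ) (h i)
      filter_upwards [eventually_all.2 hx] with n hn
      exact (hM n x hn).trans le_sup_right

/-! ### From `Bdd` to Menger's property -/

/-- In a Lindelöf space with a clopen basis, each open cover has a countable clopen refinement. -/
theorem exists_seq_isClopen_refinement {X : Type*} [TopologicalSpace X] [LindelofSpace X]
    [Nonempty X] (hX : ∀ (x : X) (V : Set X), IsOpen V → x ∈ V → ∃ A, IsClopen A ∧ x ∈ A ∧ A ⊆ V)
    (O : Set (Set X)) (hO : ∀ V ∈ O, IsOpen V) (hcov : ∀ x, ∃ V ∈ O, x ∈ V) :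
    ∃ (A V : ℕ → Set X), (∀ m, IsClopen (A m) ∧ V m ∈ O ∧ A m ⊆ V m) ∧ ∀ x, ∃ m, x ∈ A m := by
  choose V hVO hxV using hcov
  choose A hA hxA hAV using fun x => hX x (V x) (hO _ (hVO x)) (hxV x)
  obtain ⟨t, ht, hcover⟩ := isLindelof_univ.elim_nhds_subcover A
    fun x _ => (hA x).isOpen.mem_nhds (hxA x)
  have hne : t.Nonempty := by
    obtain ⟨x⟩ := ‹Nonempty X›
    obtain ⟨y, hy, -⟩ := mem_iUnion₂.1 (hcover.2 (mem_univ x))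
    exact ⟨y, hy⟩
  obtain ⟨e, rfl⟩ := ht.exists_eq_range hne
  refine ⟨fun m => A (e m), fun m => V (e m), fun m => ⟨hA _, hVO _, hAV _⟩, fun x => ?_⟩
  obtain ⟨_, ⟨m, rfl⟩, hm⟩ := mem_iUnion₂.1 (hcover.2 (mem_univ x))
  exact ⟨m, hm⟩

/-- `Bdd(F)` implies the selection principle of Menger for countable clopen covers. -/
theorem Bdd.exists_selection {F : Filter ℕ} [F.NeBot] {X : Type*} [TopologicalSpace X]
    (hX : Bdd F X) (A : ℕ → ℕ → Set X) (hA : ∀ n m, IsClopen (A n m))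
    (hcov : ∀ n x, ∃ m, x ∈ A n m) : ∃ g : ℕ → ℕ, ∀ x, ∃ n, ∃ m ≤ g n, x ∈ A n m := by
  classical
  let Ψ : X → ℕ → ℕ := fun x n => Nat.find (hcov n x)
  have hΨ : Continuous Ψ := by
    refine continuous_pi fun n => continuous_discrete_rng.2 fun m => ?_
    have : (fun x => Ψ x n) ⁻¹' {m} = A n m ∩ ⋂ l ∈ Finset.range m, (A n l)ᶜ := by
      ext x
      simp [Ψ, Nat.find_eq_iff]
    rw [this]
    exact (hA n m).isOpen.inter
      (isOpen_biInter_finset fun l _ => (hA n l).compl.isOpen)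
  obtain ⟨g, hg⟩ := hX Ψ hΨ
  refine ⟨g, fun x => ?_⟩
  obtain ⟨n, hn⟩ := (hg _ ⟨x, rfl⟩).exists
  exact ⟨n, _, hn, Nat.find_spec (hcov n x)⟩

theorem Bdd.mengerBasisProperty {F : Filter ℕ} [F.NeBot] {X : Type*} [MetricSpace X]
    [LindelofSpace X] [Nonempty X] (hX : Bdd F X)
    (hclopen : ∀ (x : X) (V : Set X), IsOpen V → x ∈ V → ∃ A, IsClopen A ∧ x ∈ A ∧ A ⊆ V) :
    MengerBasisProperty X := by
  intro B hB
  have hcov : ∀ (n : ℕ) (x : X), ∃ V ∈ {V ∈ B | Metric.ediam V ≤ 2 * (n + 1 : ENNReal)⁻¹}, x ∈ V := by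
    intro n x
    have hpos : 0 < ((n : ENNReal) + 1)⁻¹ := by simp
    obtain ⟨V, hV, hxV, hVs⟩ := hB.mem_nhds_iff.1 (Metric.eball_mem_nhds x hpos)
    exact ⟨V, ⟨hV, (Metric.ediam_mono hVs).trans Metric.ediam_eball_le⟩, hxV⟩
  choose A V hAV hA using fun n => exists_seq_isClopen_refinement hclopen _
    (fun V hV => hB.isOpen hV.1) (hcov n)
  obtain ⟨g, hg⟩ := hX.exists_selection A (fun n m => (hAV n m).1) hA
  obtain ⟨e⟩ : Nonempty (ℕ ≃ Σ n, Fin (g n + 1)) := by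
    have : Infinite (Σ n, Fin (g n + 1)) :=
      Infinite.of_injective (fun n => ⟨n, 0⟩) fun m n h => congrArg Sigma.fst h
    exact nonempty_equiv_of_countable
  refine ⟨fun i => V (e i).1 (e i).2, fun i => (hAV _ _).2.1.1, ?_, ?_⟩
  -- Each level `n` contributes only finitely many sets, so the levels tend to infinity along `e`.
  · have h1 : Tendsto (fun i => (e i).1) atTop atTop := by
      rw [← Nat.cofinite_eq_atTop]
      refine Tendsto.cofinite_of_finite_preimage_singleton fun n => ?_
      have : Finite ((fun i => (e i).1) ⁻¹' {n}) := by
        refine Finite.of_injective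
          (β := Fin (g n + 1)) (fun i => (e i.1).2.cast (by rw [show (e i.1).1 = n from i.2])) ?_
        rintro ⟨i, hi⟩ ⟨j, hj⟩ hij
        refine Subtype.ext (e.injective (Sigma.ext (hi.trans hj.symm) ?_))
        refine (Fin.heq_ext_iff (by rw [show (e i).1 = n from hi, show (e j).1 = n from hj])).2 ?_
        simpa [Fin.ext_iff] using hij
      exact toFinite _
    have h2 : Tendsto (fun n : ℕ => 2 * (n + 1 : ENNReal)⁻¹) atTop (𝓝 0) := by
      have h3 := (tendsto_add_atTop_iff_nat 1).2 ENNReal.tendsto_inv_nat_nhds_zero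
      have := ENNReal.Tendsto.const_mul (a := 2) h3 (Or.inr (by simp))
      simpa using this
    exact tendsto_of_tendsto_of_tendsto_of_le_of_le tendsto_const_nhds (h2.comp h1)
      (fun _ => zero_le) fun i => (hAV _ _).2.1.2
  · refine eq_univ_of_forall fun x => ?_
    obtain ⟨n, m, hm, hx⟩ := hg x
    refine mem_iUnion.2 ⟨e.symm ⟨n, m, Nat.lt_succ_of_le hm⟩, ?_⟩
    rw [Equiv.apply_symm_apply]
    exact (hAV n m).2.2 hx

theorem Bdd.mengerProperty {F : Filter ℕ} [F.NeBot] {X : Type*} [t : TopologicalSpace X]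
    [TopologicalSpace.MetrizableSpace X] [LindelofSpace X] [Nonempty X] (hX : Bdd F X)
    (hclopen : ∀ (x : X) (V : Set X), IsOpen V → x ∈ V → ∃ A, IsClopen A ∧ x ∈ A ∧ A ⊆ V) :
    MengerProperty X := by
  refine ⟨‹_›, fun d hdt => ?_⟩
  subst hdt
  exact hX.mengerBasisProperty hclopen

/-- Needed for the clopen basis of the compact product spaces. -/
instance : TotallyDisconnectedSpace (OnePoint ℕ) := by
  refine ⟨fun s _ hs x hx y hy => ?_⟩
  by_contra hne
  obtain ⟨a, ha⟩ : ∃ a : ℕ, (a : OnePoint ℕ) = x ∨ (a : OnePoint ℕ) = y := by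
    by_cases h : x = OnePoint.infty
    · obtain ⟨a, ha⟩ := OnePoint.ne_infty_iff_exists.1 fun h' => hne (h.trans h'.symm)
      exact ⟨a, Or.inr ha⟩
    · obtain ⟨a, ha⟩ := OnePoint.ne_infty_iff_exists.1 h
      exact ⟨a, Or.inl ha⟩
  have := fun h => hs.subset_isClopen (isClopen_singleton_onePoint a) h
  rcases ha with rfl | rfl
  · exact hne (this ⟨_, hx, rfl⟩ hy).symm
  · exact hne (this ⟨_, hy, rfl⟩ hx)

theorem mengerProperty_pi_of_bdd {F : Filter ℕ} [F.NeBot] {X : Set (ℕ → OnePoint ℕ)}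
    (hX : X.Nonempty) (k : ℕ) (h : Bdd F (Fin k → X)) : MengerProperty (Fin k → X) := by
  have := hX.to_subtype
  have hind : IsInducing fun (x : Fin k → X) (i : Fin k) => (x i : ℕ → OnePoint ℕ) :=
    IsInducing.piMap fun _ => IsInducing.subtypeVal
  refine h.mengerProperty fun x V hV hx => ?_
  have hbasis := isTopologicalBasis_isClopen (X := Fin k → ℕ → OnePoint ℕ)
  obtain ⟨_, ⟨A, hA, rfl⟩, hxA, hAV⟩ := (hbasis.isInducing hind).mem_nhds_iff.1 (hV.mem_nhds hx)
  exact ⟨_, IsClopen.preimage hA hind.continuous, hxA, hAV⟩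

/-! ### Failure of the Hurewicz property -/

/-- If the ranges of the functions `f a` are co-infinite, and contain arbitrarily long intervals in
the sense that no function bounds their lengths, then `S ∪ Q` is not Hurewicz. -/
theorem not_hurewiczProperty_scaleUnion {ι : Type*} {f : ι → ℕ → ℕ} (hf : ∀ a, StrictMono (f a))
    (hinf : ∀ a, (range (f a))ᶜ.Infinite)
    (hgap : ∀ g : ℕ → ℕ, ∃ a, ∃ᶠ n in atTop, Icc n (g n) ⊆ range (f a)) :
    ¬ HurewiczProperty (scaleUnion f) := by
  classical
  -- Strictly increasing sequences satisfy `i ≤ f i`, so the bound `i ≤ m` loses no occurrence of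
  -- `m` and makes `H m` clopen.
  let H : ℕ → Set (scaleUnion f) := fun m => {x | ∃ i ≤ m, (x : ℕ → OnePoint ℕ) i = m}
  have hH : ∀ m, IsClopen (H m) := fun m => by
    have : H m = ⋃ i ∈ Finset.range (m + 1),
        Subtype.val ⁻¹' {x : ℕ → OnePoint ℕ | x i = m} := by
      ext x
      simp [H]
    rw [this]
    exact isClopen_biUnion_finset fun i _ =>
      (isClopen_apply_eq_coe i m).preimage continuous_subtype_val
  have hcoe : ∀ (a : ι) (m : ℕ) (h : toCompact (f a) ∈ scaleUnion f),
      (⟨toCompact (f a), h⟩ : scaleUnion f) ∈ H m ↔ m ∈ range (f a) := by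
    intro a m h
    constructor
    · rintro ⟨i, -, hi⟩
      exact ⟨i, OnePoint.coe_injective hi⟩
    · rintro ⟨i, rfl⟩
      exact ⟨i, (hf a).le_apply, rfl⟩
  have hex : ∀ (x : scaleUnion f) (n : ℕ), ∃ j, n ≤ j ∧ x ∉ H j := by
    rintro ⟨x, hx⟩ n
    rcases hx with ⟨a, rfl⟩ | ⟨m, s, hs, rfl⟩
    · obtain ⟨j, hj, hnj⟩ := (hinf a).exists_gt n
      exact ⟨j, hnj.le, fun h => hj ((hcoe a j _).1 h)⟩
    · refine ⟨n + ∑ i, s i + 1, by omega, ?_⟩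
      rintro ⟨i, -, hi⟩
      by_cases him : i < m
      · simp only [extendByInfty, dif_pos him] at hi
        have h1 := OnePoint.coe_injective hi
        have h2 := Finset.single_le_sum (f := s) (fun _ _ => Nat.zero_le _)
          (Finset.mem_univ ⟨i, him⟩)
        omega
      · simp [extendByInfty, dif_neg him] at hi
  let Ψ : scaleUnion f → ℕ → ℕ := fun x n => Nat.find (hex x n)
  have hΨ : Continuous Ψ := by
    refine continuous_pi fun n => continuous_discrete_rng.2 fun j => ?_
    have : (fun x => Ψ x n) ⁻¹' {j} = {_x | n ≤ j} ∩ ((H j)ᶜ ∩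
        ⋂ l ∈ Finset.range j, ({_x | ¬ n ≤ l} ∪ H l)) := by
      ext x
      simp [Ψ, Nat.find_eq_iff, and_assoc, imp_iff_not_or]
    rw [this]
    exact isOpen_const.inter ((hH j).compl.isOpen.inter
      (isOpen_biInter_finset fun l _ => isOpen_const.union (hH l).isOpen))
  intro hHur
  obtain ⟨g, hg⟩ := hHur Ψ hΨ
  obtain ⟨a, ha⟩ := hgap g
  have hmem : toCompact (f a) ∈ scaleUnion f := Or.inl ⟨a, rfl⟩
  have h1 := hg ⟨_, hmem⟩
  rw [Nat.cofinite_eq_atTop] at h1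
  obtain ⟨n, hn, hle⟩ := (ha.and_eventually h1).exists
  obtain ⟨h2, h3⟩ := Nat.find_spec (hex ⟨_, hmem⟩ n)
  exact h3 ((hcoe a _ hmem).2 (hn ⟨h2, hle⟩))

theorem theorem4p5 (hd : dominatingNumber.IsRegular) :
    ∃ U : Ultrafilter ℕ, (U : Filter ℕ) ≤ cofinite ∧
      boundingNumber (U : Filter ℕ) = dominatingNumber ∧
      ∃ f : Set.Iio (boundingNumber (U : Filter ℕ)).ord → ℕ → ℕ,
        IsScale (U : Filter ℕ) f ∧
        (∀ k : ℕ, Bdd (U : Filter ℕ) (Fin k → scaleUnion f)) ∧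
        (∀ k : ℕ, MengerProperty (Fin k → scaleUnion f)) ∧
        ¬ HurewiczProperty (scaleUnion f) := by
  obtain ⟨U, hU, hb⟩ := exists_boundingNumber_eq hd
  obtain ⟨f, hf, hinf, hgap⟩ := exists_isScale_frequently_Icc hU hb
  refine ⟨U, hU, hb, f, hf, hf.bdd_pi hU, fun k => ?_,
    not_hurewiczProperty_scaleUnion hf.strictMono hinf hgap⟩
  exact mengerProperty_pi_of_bdd
    ⟨_, Or.inr ⟨0, Fin.elim0, fun i => i.elim0, rfl⟩⟩ k (hf.bdd_pi hU k)
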